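/- Let $L$ be a slim, planar, semimodular (SPS) lattice: a finite semimodular lattice that has a planar Hasse diagram and has no sublattice isomorphic to $M_3$. Let $S=\{o,a_l,a_r,t\}$ be a covering square of $L$, that is, a four-element Boolean sublattice with $o\prec a_l\prec t$ and $o\prec a_r\prec t$. Let $W$ be the set of all prime intervals of $L$ that are reached from $[o,a_l]$ or $[o,a_r]$ by finitely many (possibly zero) steps of the form: from $[u,w]$ to $[x,z]$, where $\{x,z,u,w\}$ is a covering square of $L$ with bottom $x$, top $w$ and middle elements $z,u$. The fork extension $L[S]$ is obtained from $L$ by adding one new element $z_{\mathfrak p}$ for every $\mathfrak p\in W$ and one further new element $m$; its order is the reflexive and transitive closure of the order of $L$ together with: $y<z_{\mathfrak p}<x$ for $\mathfrak p=[y,x]\in W$; $z_{\mathfrak q}<z_{\mathfrak p}$ if $\mathfrak q$ is obtained from $\mathfrak p$ by one such step; $z_{[o,a_l]}<m$, $z_{[o,a_r]}<m$ and $m<t$. With this order $L[S]$ is a lattice and $L$ is a sublattice of it. A congruence $\alpha$ of $L$ extends to $L[S]$ if there is a congruence $\beta$ of $L[S]$ whose restriction to $L$ is $\alpha$. **Theorem.**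 For every $L$ and $S$ as above and every congruence $\alpha$ of $L$: (i) if the restriction of $\alpha$ to $S$ is the all relation on $S$, then $\alpha$ extends to $L[S]$; (ii) if the restriction of $\alpha$ to $S$ is the identity relation on $S$, then $\alpha$ extends to $L[S]$. (iii) If the restriction of $\alpha$ to $S$ is neither the all relation nor the identity relation, then $\alpha$ may or may not extend to $L[S]$: there are such $L$, $S$, $\alpha$ for which $\alpha$ extends to $L[S]$, and there are such $L$, $S$, $\alpha$ for which it does not. -/

import Mathlib

/-- A planar diagram of an ordered set: the elements are drawn as distinct points of the plane, each
covering pair as a straight line segment rising from the smaller to the larger element. No element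
lies on a segment of which it is not an end point, and two different segments meet at most in a
common end point. -/
structure IsPlanarDiagram {L : Type*} [PartialOrder L] (pos : L → ℝ × ℝ) : Prop where
  injective : Function.Injective pos
  upward : ∀ a b : L, a ⋖ b → (pos a).2 < (pos b).2
  vertex_edge : ∀ a b c : L, a ⋖ b → pos c ∈ segment ℝ (pos a) (pos b) → c = a ∨ c = b
  edge_edge : ∀ a b c d : L, a ⋖ b → c ⋖ d → (a, b) ≠ (c, d) →
    segment ℝ (pos a) (pos b) ∩ segment ℝ (pos c) (pos d) ⊆ pos '' (({a, b} : Set L) ∩ {c, d})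

/-- An ordered set is planar if it has a planar diagram. -/
def IsPlanarOrder (L : Type*) [PartialOrder L] : Prop :=
  ∃ pos : L → ℝ × ℝ, IsPlanarDiagram pos

/-- A lattice is slim if it has no sublattice `{o, a, b, c, i}` isomorphic to the five-element
modular nondistributive lattice `M₃`. -/
def IsSlim (L : Type*) [Lattice L] : Prop :=
  ¬ ∃ o a b c i : L, [o, a, b, c, i].Nodup ∧
    a ⊓ b = o ∧ a ⊓ c = o ∧ b ⊓ c = o ∧ a ⊔ b = i ∧ a ⊔ c = i ∧ b ⊔ c = i

/-- Slim, planar, semimodular (SPS) lattices. `IsUpperModularLattice` is semimodularity. -/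
structure IsSPS (L : Type*) [Lattice L] : Prop where
  finite : Finite L
  slim : IsSlim L
  planar : IsPlanarOrder L
  semimodular : IsUpperModularLattice L

/-- A covering square `{o, al, ar, t}`: a four-element Boolean sublattice all of whose edges are
coverings (`al ⊓ ar = o` and `al ⊔ ar = t` follow from the coverings). -/
structure CoveringSquare (L : Type*) [Lattice L] where
  o : L
  al : L
  ar : L
  t : L
  al_ne_ar : al ≠ ar
  o_al : o ⋖ al
  o_ar : o ⋖ ar
  al_t : al ⋖ t
  ar_t : ar ⋖ t

namespace CoveringSquare

variable {L : Type*} [Lattice L]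

/-- The four elements of the square. -/
def carrier (S : CoveringSquare L) : Set L := {S.o, S.al, S.ar, S.t}

/-- `DownStep (u, w) (x, z)`: there is a covering square `{x, z, u, w}` of `L` with bottom `x`,
top `w` and the two middle elements `z`, `u`; so the prime interval `[x, z]` is the lower opposite
side of `[u, w]`. -/
def DownStep (p q : L × L) : Prop :=
  ∃ T : CoveringSquare L, p = (T.ar, T.t) ∧ q = (T.o, T.al)

/-- The wing starting with the prime interval `p`: all prime intervals that are reached from `p` by
successively passing down to opposite sides of covering squares. -/
def wing (p : L × L) : Set (L × L) := {q | Relation.ReflTransGen DownStep p q}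

/-- The prime intervals of the left wing `[o, al], …` and of the right wing `[o, ar], …` of `S`. -/
def wings (S : CoveringSquare L) : Set (L × L) := wing (S.o, S.al) ∪ wing (S.o, S.ar)

/-- The elements of the fork extension `L[S]`: the elements of `L`, one new element `z` for each
prime interval `[y, x]` in the wings of `S`, and the new element `m`. -/
inductive Fork (S : CoveringSquare L) : Type _
  | old (x : L) : Fork S
  | z (p : S.wings) : Fork S
  | m : Fork S

namespace Fork

variable {S : CoveringSquare L}

/-- The relations that generate the order of `L[S]`: the order of `L`; `y < z < x` for the element
`z` inserted into the prime interval `[y, x]`; `z' < z` if the interval of `z'` follows the interval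
of `z` in a wing; `b < m` for the two elements `b` inserted into `[o, al]` and `[o, ar]`;
and `m < t`. -/
inductive Gen : Fork S → Fork S → Prop
  | old {x y : L} : x ≤ y → Gen (old x) (old y)
  | lower (p : S.wings) : Gen (old p.1.1) (z p)
  | upper (p : S.wings) : Gen (z p) (old p.1.2)
  | step (p q : S.wings) : DownStep p.1 q.1 → Gen (z q) (z p)
  | left : Gen (z ⟨(S.o, S.al), Or.inl Relation.ReflTransGen.refl⟩) m
  | right : Gen (z ⟨(S.o, S.ar), Or.inr Relation.ReflTransGen.refl⟩) m
  | top : Gen m (old S.t)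

/-- Used only to see that the generated order is antisymmetric. -/
def bounds : Fork S → L × L
  | old x => (x, x)
  | z p => p.1
  | m => (S.o, S.t)

theorem wing_covBy {p q : L × L} (hp : p.1 ⋖ p.2) (h : q ∈ wing p) : q.1 ⋖ q.2 := by
  induction h with
  | refl => exact hp
  | tail _ h _ =>
    obtain ⟨T, -, rfl⟩ := h
    exact T.o_al

theorem wings_covBy (p : S.wings) : p.1.1 ⋖ p.1.2 := by
  rcases p.2 with h | h
  · exact wing_covBy S.o_al h
  · exact wing_covBy S.o_ar h

theorem bounds_injective : Function.Injective (bounds : Fork S → L × L) := by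
  have ht : ¬ S.o ⋖ S.t := fun h => h.2 S.o_al.lt S.al_t.lt
  have hlt : S.o < S.t := S.o_al.lt.trans S.al_t.lt
  intro a b h
  cases a <;> cases b <;> simp only [bounds, Prod.ext_iff] at h
  · rw [h.1]
  · rename_i x p
    exact absurd (wings_covBy p).lt (by rw [← h.1, ← h.2]; exact lt_irrefl _)
  · exact absurd hlt (by rw [← h.1, ← h.2]; exact lt_irrefl _)
  · rename_i p x
    exact absurd (wings_covBy p).lt (by rw [h.1, h.2]; exact lt_irrefl _)
  · rename_i p q
    congr 1
    exact Subtype.ext (Prod.ext h.1 h.2)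
  · rename_i p
    exact absurd (wings_covBy p) (by rw [h.1, h.2]; exact ht)
  · exact absurd hlt (by rw [h.1, h.2]; exact lt_irrefl _)
  · rename_i p
    exact absurd (wings_covBy p) (by rw [← h.1, ← h.2]; exact ht)
  · rfl

theorem bounds_mono {a b : Fork S} (h : Relation.ReflTransGen Gen a b) : bounds a ≤ bounds b := by
  induction h with
  | refl => exact le_rfl
  | tail _ h ih =>
    refine ih.trans ?_
    cases h with
    | old h => exact ⟨h, h⟩
    | lower p => exact ⟨le_rfl, (wings_covBy p).le⟩
    | upper p => exact ⟨(wings_covBy p).le, le_rfl⟩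
    | step p q h =>
      obtain ⟨T, hp, hq⟩ := h
      simp only [bounds, hp, hq]
      exact ⟨T.o_ar.le, T.al_t.le⟩
    | left => exact ⟨le_rfl, S.al_t.le⟩
    | right => exact ⟨le_rfl, S.ar_t.le⟩
    | top => exact ⟨(S.o_al.lt.trans S.al_t.lt).le, le_rfl⟩

/-- The order of `L[S]`: the reflexive and transitive closure of `Gen`. -/
@[reducible] def order (S : CoveringSquare L) : PartialOrder (Fork S) where
  le := Relation.ReflTransGen Gen
  le_refl _ := Relation.ReflTransGen.refl
  le_trans _ _ _ := Relation.ReflTransGen.trans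
  le_antisymm _ _ h h' := bounds_injective (le_antisymm (bounds_mono h) (bounds_mono h'))

end Fork

/-- The lattice extension `L[S]` of `L`: lattice operations on `L[S]` belonging to the order of
`L[S]`, for which `L` is a sublattice. (There is at most one such structure, since the lattice
operations are determined by the order.) -/
structure ForkLattice (S : CoveringSquare L) where
  lattice : Lattice (Fork S)
  order_eq : lattice.toSemilatticeSup.toPartialOrder = Fork.order S
  incl : LatticeHom L (Fork S)
  incl_eq : ∀ x : L, incl x = Fork.old x

/-- The congruence `α` of `L` extends to `L[S]`: some congruence of `L[S]` restricts to `α`. -/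
def ForkLattice.Extends {S : CoveringSquare L} (K : ForkLattice S) (α : LatticeCon L) : Prop :=
  letI := K.lattice
  ∃ β : LatticeCon (Fork S), ∀ x y : L, β.r (Fork.old x) (Fork.old y) ↔ α.r x y

/-- The restriction of `α` to `S` is the all relation. -/
def RestrictsToOne (S : CoveringSquare L) (α : LatticeCon L) : Prop :=
  ∀ x ∈ S.carrier, ∀ y ∈ S.carrier, α.r x y

/-- The restriction of `α` to `S` is the identity relation. -/
def RestrictsToZero (S : CoveringSquare L) (α : LatticeCon L) : Prop :=
  ∀ x ∈ S.carrier, ∀ y ∈ S.carrier, α.r x y → x = y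

end CoveringSquare

/-! Each element of L[S] is encoded by an interval of L: an old x by [x, x], z_p by p, and m by [o,
t]. Slimness and planarity are used only through `IsSPS.atMostTwoCovers`. Together with
semimodularity and finiteness it shows that the wings consist exactly of the prime intervals [y, x]
with y ≤ o and x ≰ o (`mem_wings_iff`), and that the order of L[S] is the componentwise order of the
intervals (`order_le_iff`). A new interval has the form [o ⊓ h, h]. The upper ends h allowed here
(`IsForkTop`) are closed under joins (`IsForkTop.sup`), so below each element there is a greatest
one; this gives explicit formulas for join and meet.

If α is the all relation on S, it collapses every encoding interval, and comparing lower ends modulo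
α is a congruence. If α is the identity on S, both ends are compared: the ideal of o is then a union
of α-classes and fork tops can be transported along α, so the formulas respect α. For (iii), one
square of a nine-element lattice carries both examples: a prime filter of L extended to a prime
filter of L[S], and a collapsed side of S which in L[S] forces the collapse of a distant edge. -/

/-! ### Planar diagrams: maximal chains as graphs over the height. -/

/-- The first coordinate, at height `y`, of the line through the points `P` and `Q`. -/
noncomputable def lineAt (P Q : ℝ × ℝ) (y : ℝ) : ℝ :=
  P.1 + (y - P.2) * ((Q.1 - P.1) / (Q.2 - P.2))

theorem lineAt_left (P Q : ℝ × ℝ) : lineAt P Q P.2 = P.1 := by simp [lineAt]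

theorem lineAt_right {P Q : ℝ × ℝ} (h : P.2 < Q.2) : lineAt P Q Q.2 = Q.1 := by
  have : Q.2 - P.2 ≠ 0 := by linarith
  simp only [lineAt]
  field_simp
  ring

theorem continuous_lineAt (P Q : ℝ × ℝ) : Continuous (lineAt P Q) := by
  unfold lineAt
  fun_prop

theorem lineAt_mem_segment {P Q : ℝ × ℝ} (h : P.2 < Q.2) {y : ℝ} (hP : P.2 ≤ y) (hQ : y ≤ Q.2) :
    (lineAt P Q y, y) ∈ segment ℝ P Q := by
  have h0 : 0 < Q.2 - P.2 := by linarith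
  rw [segment_eq_image]
  refine ⟨(y - P.2) / (Q.2 - P.2), ⟨by apply div_nonneg <;> linarith, ?_⟩, ?_⟩
  · rw [div_le_one h0]
    linarith
  · ext
    · simp only [lineAt, Prod.fst_add, Prod.smul_fst, smul_eq_mul]
      field_simp
      ring
    · simp only [Prod.snd_add, Prod.smul_snd, smul_eq_mul]
      field_simp
      ring

namespace IsPlanarDiagram

variable {L : Type*} [PartialOrder L] {pos : L → ℝ × ℝ}

theorem le_height [Finite L] (hp : IsPlanarDiagram pos) {a b : L} (h : a ≤ b) :
    (pos a).2 ≤ (pos b).2 := by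
  induction a using WellFoundedGT.induction with
  | ind a ih =>
    rcases h.eq_or_lt with rfl | h
    · exact le_rfl
    · obtain ⟨c, hc, hcb⟩ := exists_covBy_le_of_lt h
      exact (hp.upward _ _ hc).le.trans (ih c hc.lt hcb)

/-- A maximal chain from `x` to `v` through the cover `a` of `x`, as the graph of a function of the
height. -/
theorem exists_path [Finite L] (hp : IsPlanarDiagram pos) {x a v : L} (hxa : x ⋖ a) (hav : a ≤ v) :
    ∃ g : ℝ → ℝ, Continuous g ∧ (∀ y ≤ (pos a).2, g y = lineAt (pos x) (pos a) y) ∧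
      g (pos v).2 = (pos v).1 ∧ ∀ y, (pos x).2 ≤ y → y ≤ (pos v).2 →
        ∃ c d, c ⋖ d ∧ d ≤ v ∧ (c = x ∧ d = a ∨ a ≤ c) ∧ (g y, y) ∈ segment ℝ (pos c) (pos d) := by
  induction a using WellFoundedGT.induction generalizing x with
  | ind a ih =>
    have hup := hp.upward _ _ hxa
    rcases hav.eq_or_lt with rfl | hlt
    · exact ⟨_, continuous_lineAt _ _, fun _ _ => rfl, lineAt_right hup, fun y h1 h2 =>
        ⟨x, a, hxa, le_rfl, Or.inl ⟨rfl, rfl⟩, lineAt_mem_segment hup h1 h2⟩⟩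
    · obtain ⟨b, hab, hbv⟩ := exists_covBy_le_of_lt hlt
      obtain ⟨g, hg, hg1, hg2, hg3⟩ := ih b hab.lt hab hbv
      have hupb := hp.upward _ _ hab
      refine ⟨fun y => if y ≤ (pos a).2 then lineAt (pos x) (pos a) y else g y, ?_, ?_, ?_, ?_⟩
      · refine Continuous.if_le (continuous_lineAt _ _) hg continuous_id continuous_const ?_
        rintro y rfl
        rw [hg1 _ hupb.le, lineAt_right hup, lineAt_left]
      · intro y hy
        simp only [hy, if_true]
      · have := hp.le_height hbv
        simp only [not_le.2 (hupb.trans_le this), if_false, hg2]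
      · intro y h1 h2
        by_cases hy : y ≤ (pos a).2
        · refine ⟨x, a, hxa, hav, Or.inl ⟨rfl, rfl⟩, ?_⟩
          simp only [hy, if_true]
          exact lineAt_mem_segment hup h1 hy
        · obtain ⟨c, d, hcd, hdv, hc, hs⟩ := hg3 y (le_of_not_ge hy) h2
          refine ⟨c, d, hcd, hdv, Or.inr ?_, ?_⟩
          · rcases hc with ⟨rfl, -⟩ | hc
            exacts [le_rfl, hab.le.trans hc]
          · simpa only [hy, if_false] using hs

/-- If a path through the cover `a` of `x` meets, above `x`, a path through another cover `b`, then
`b` is below the end of the first path. -/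
theorem le_of_edges_meet (hp : IsPlanarDiagram pos) {x a b v c d c' d' : L}
    (hab : a ≠ b) (hxa : x ⋖ a) (hxb : x ⋖ b) {p : ℝ × ℝ} (hx : (pos x).2 < p.2)
    (hcd : c ⋖ d) (hdv : d ≤ v) (hc : c = x ∧ d = a ∨ a ≤ c) (hs : p ∈ segment ℝ (pos c) (pos d))
    (hcd' : c' ⋖ d') (hc' : c' = x ∧ d' = b ∨ b ≤ c')
    (hs' : p ∈ segment ℝ (pos c') (pos d')) : b ≤ v := by
  -- A common edge cannot be the first edge of the second path, so it lies above `b`. Otherwise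
  -- planarity makes the common point a vertex, and it is not `x` because it is higher.
  by_cases heq : (c, d) = (c', d')
  · obtain ⟨rfl, rfl⟩ := Prod.mk.inj heq
    rcases hc' with ⟨rfl, rfl⟩ | hc'
    · rcases hc with ⟨-, rfl⟩ | hc
      · exact absurd rfl hab
      · exact absurd hc hxa.lt.not_ge
    · exact hc'.trans (hcd.le.trans hdv)
  · obtain ⟨w, ⟨hw, hw'⟩, rfl⟩ := hp.edge_edge c d c' d' hcd hcd' heq ⟨hs, hs'⟩
    have hwx : w ≠ x := by rintro rfl; exact lt_irrefl _ hx
    have hwv : w ≤ v := by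
      rcases hw with rfl | rfl
      exacts [hcd.le.trans hdv, hdv]
    refine le_trans ?_ hwv
    rcases hc' with ⟨rfl, rfl⟩ | hc'
    · rcases hw' with rfl | rfl
      exacts [absurd rfl hwx, le_rfl]
    · rcases hw' with rfl | rfl
      exacts [hc', hc'.trans hcd'.le]

/-- The slope, with respect to the vertical axis, of the edge from `x` to `a`. -/
noncomputable def slope (pos : L → ℝ × ℝ) (x a : L) : ℝ :=
  ((pos a).1 - (pos x).1) / ((pos a).2 - (pos x).2)

/-- Edges of equal slope overlap just above `x`; `le_of_edges_meet` then makes two distinct covers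
comparable. -/
theorem slope_ne (hp : IsPlanarDiagram pos) {x a b : L} (hab : a ≠ b) (hxa : x ⋖ a) (hxb : x ⋖ b) :
    slope pos x a ≠ slope pos x b := by
  intro h
  have ha := hp.upward _ _ hxa
  have hb := hp.upward _ _ hxb
  have h1 : (pos x).2 < min (pos a).2 (pos b).2 := lt_min ha hb
  have hs := lineAt_mem_segment ha h1.le (min_le_left _ _)
  have hs' := lineAt_mem_segment hb h1.le (min_le_right _ _)
  have heq : lineAt (pos x) (pos a) = lineAt (pos x) (pos b) := by
    funext y
    unfold slope at h
    simp only [lineAt, h]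
  rw [← heq] at hs'
  have := hp.le_of_edges_meet hab hxa hxb h1 hxa le_rfl (Or.inl ⟨rfl, rfl⟩) hs hxb
    (Or.inl ⟨rfl, rfl⟩) hs'
  exact hxa.2 hxb.lt (lt_of_le_of_ne this hab.symm)

/-- Of three covers of `x`, the middle one is below every common upper bound of the outer ones. -/
theorem le_of_slope_lt [Finite L] (hp : IsPlanarDiagram pos) {x a b c s v : L}
    (hxa : x ⋖ a) (hxb : x ⋖ b) (hxc : x ⋖ c) (hab : slope pos x a < slope pos x b)
    (hbc : slope pos x b < slope pos x c) (has : a ≤ s) (hcs : c ≤ s)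
    (hbv : b ≤ v) (hsv : s ≤ v) : b ≤ s := by
  obtain ⟨f, hf, hf1, hf2, hf3⟩ := hp.exists_path hxa has
  obtain ⟨g, hg, hg1, -, hg3⟩ := hp.exists_path hxb hbv
  obtain ⟨k, hk, hk1, hk2, hk3⟩ := hp.exists_path hxc hcs
  have hab' : a ≠ b := by rintro rfl; exact lt_irrefl _ hab
  have hcb' : c ≠ b := by rintro rfl; exact lt_irrefl _ hbc
  have ha := hp.upward _ _ hxa
  have hb := hp.upward _ _ hxb
  have hc := hp.upward _ _ hxc
  have hsT := hp.le_height hsv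
  have has' := hp.le_height has
  obtain ⟨y, hy, hya, hyb, hyc⟩ : ∃ y, (pos x).2 < y ∧ y ≤ (pos a).2 ∧ y ≤ (pos b).2 ∧
      y ≤ (pos c).2 :=
    ⟨min (pos a).2 (min (pos b).2 (pos c).2), lt_min ha (lt_min hb hc), min_le_left _ _,
      (min_le_right _ _).trans (min_le_left _ _), (min_le_right _ _).trans (min_le_right _ _)⟩
  have hys : y ≤ (pos s).2 := hya.trans has'
  have hfg : f y < g y := by
    rw [hf1 y hya, hg1 y hyb]
    exact add_lt_add_right (mul_lt_mul_of_pos_left hab (by linarith)) _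
  have hgk : g y < k y := by
    rw [hk1 y hyc, hg1 y hyb]
    exact add_lt_add_right (mul_lt_mul_of_pos_left hbc (by linarith)) _
  -- Just above `x` the path through `b` runs between the outer two, which both end in `s`. At the
  -- height of `s`, which it reaches since `s ≤ v`, it is on one side of `s` or at `s`, so it has
  -- met the outer path of that side.
  rcases le_total (g (pos s).2) (pos s).1 with h | h
  · obtain ⟨w, hw, he⟩ := isPreconnected_Icc.intermediate_value₂ (Set.left_mem_Icc.2 hys)
      (Set.right_mem_Icc.2 hys) hf.continuousOn hg.continuousOn hfg.le (h.trans hf2.ge)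
    obtain ⟨p, q, hpq, hqs, hpa, hs⟩ := hf3 w (hy.le.trans hw.1) hw.2
    obtain ⟨p', q', hpq', -, hpb, hs'⟩ := hg3 w (hy.le.trans hw.1) (hw.2.trans hsT)
    rw [← he] at hs'
    exact hp.le_of_edges_meet hab' hxa hxb (hy.trans_le hw.1) hpq hqs hpa hs hpq' hpb hs'
  · obtain ⟨w, hw, he⟩ := isPreconnected_Icc.intermediate_value₂ (Set.left_mem_Icc.2 hys)
      (Set.right_mem_Icc.2 hys) hg.continuousOn hk.continuousOn hgk.le (hk2.le.trans h)
    obtain ⟨p, q, hpq, hqs, hpa, hs⟩ := hk3 w (hy.le.trans hw.1) hw.2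
    obtain ⟨p', q', hpq', -, hpb, hs'⟩ := hg3 w (hy.le.trans hw.1) (hw.2.trans hsT)
    rw [he] at hs'
    exact hp.le_of_edges_meet hcb' hxc hxb (hy.trans_le hw.1) hpq hqs hpa hs hpq' hpb hs'

end IsPlanarDiagram

/-! ### At most two covers. -/

/-- Every element has at most two (upper) covers. -/
def AtMostTwoCovers (L : Type*) [PartialOrder L] : Prop :=
  ∀ x a b c : L, x ⋖ a → x ⋖ b → x ⋖ c → a = b ∨ a = c ∨ b = c

theorem CovBy.inf_eq_of_ne {L : Type*} [Lattice L] {x a b : L} (ha : x ⋖ a) (hb : x ⋖ b)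
    (h : a ≠ b) : a ⊓ b = x := by
  rcases ha.eq_or_eq (le_inf ha.le hb.le) inf_le_left with h1 | h1
  · exact h1
  · have hle : a ≤ b := inf_eq_left.1 h1
    exact absurd (lt_of_le_of_ne hle h) (hb.2 ha.lt)

theorem CovBy.covBy_sup_of_ne {L : Type*} [Lattice L] [IsUpperModularLattice L] {x a b : L}
    (ha : x ⋖ a) (hb : x ⋖ b) (h : a ≠ b) : b ⋖ a ⊔ b :=
  covBy_sup_of_inf_covBy_left (by rwa [ha.inf_eq_of_ne hb h])

/-- Of three covers, the middle one in the diagram lies below the join of the outer two. By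
semimodularity all pairwise joins then coincide, which yields an M₃. -/
theorem IsSPS.atMostTwoCovers {L : Type*} [Lattice L] (h : IsSPS L) : AtMostTwoCovers L := by
  have := h.finite
  have := h.semimodular
  obtain ⟨pos, hp⟩ := h.planar
  intro x a b c ha hb hc
  by_contra! hne
  obtain ⟨hab, hac, hbc⟩ := hne
  have key : ∀ a b c : L, x ⋖ a → x ⋖ b → x ⋖ c →
      IsPlanarDiagram.slope pos x a < IsPlanarDiagram.slope pos x b →
      IsPlanarDiagram.slope pos x b < IsPlanarDiagram.slope pos x c → False := by
    intro a b c ha hb hc h1 h2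
    have hab : a ≠ b := by rintro rfl; exact lt_irrefl _ h1
    have hbc : b ≠ c := by rintro rfl; exact lt_irrefl _ h2
    have hac : a ≠ c := by rintro rfl; exact lt_asymm h1 h2
    have hb' := hp.le_of_slope_lt ha hb hc h1 h2 le_sup_left le_sup_right
      (le_sup_left : b ≤ b ⊔ (a ⊔ c)) le_sup_right
    have hca := ha.covBy_sup_of_ne hc hac
    have hac' : a ⋖ a ⊔ c := sup_comm a c ▸ hc.covBy_sup_of_ne ha hac.symm
    have e1 : a ⊔ b = a ⊔ c := by
      refine (hac'.eq_or_eq le_sup_left (sup_le le_sup_left hb')).resolve_left fun h => ?_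
      exact (sup_comm b a ▸ (hb.covBy_sup_of_ne ha hab.symm)).ne h.symm
    have e2 : b ⊔ c = a ⊔ c := by
      refine (hca.eq_or_eq le_sup_right (sup_le hb' le_sup_right)).resolve_left fun h => ?_
      exact (hb.covBy_sup_of_ne hc hbc).ne h.symm
    refine h.slim ⟨x, a, b, c, a ⊔ c, ?_, ha.inf_eq_of_ne hb hab, ha.inf_eq_of_ne hc hac,
      hb.inf_eq_of_ne hc hbc, e1, rfl, e2⟩
    have hbs : b < a ⊔ c := e2 ▸ lt_of_le_of_ne le_sup_left fun h =>
      hb.2 hc.lt (lt_of_le_of_ne (h ▸ le_sup_right) hbc.symm)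
    simp [ha.ne, hb.ne, hc.ne, hab, hac, hbc, hca.ne, hac'.ne, hbs.ne, (hc.lt.trans hca.lt).ne,
      -left_eq_sup, -right_eq_sup]
  have n1 := hp.slope_ne hab ha hb
  have n2 := hp.slope_ne hac ha hc
  have n3 := hp.slope_ne hbc hb hc
  rcases n1.lt_or_gt with h1 | h1 <;> rcases n2.lt_or_gt with h2 | h2 <;>
    rcases n3.lt_or_gt with h3 | h3
  · exact key a b c ha hb hc h1 h3
  · exact key a c b ha hc hb h2 h3
  · exact lt_asymm (h1.trans h3) h2
  · exact key c a b hc ha hb h2 h1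
  · exact key b a c hb ha hc h1 h2
  · exact lt_asymm (h2.trans h3) h1
  · exact key b c a hb hc ha h3 h2
  · exact key c b a hc hb ha h3 h1

/-! ### Wings and fork tops. -/

namespace CoveringSquare

section

variable {L : Type*} [Lattice L]

theorem ar_not_le_al (S : CoveringSquare L) : ¬ S.ar ≤ S.al := fun h =>
  S.o_al.2 S.o_ar.lt (lt_of_le_of_ne h S.al_ne_ar.symm)

theorem al_sup_ar (S : CoveringSquare L) : S.al ⊔ S.ar = S.t :=
  (S.al_t.eq_or_eq le_sup_left (sup_le S.al_t.le S.ar_t.le)).resolve_left fun h =>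
    S.ar_not_le_al (sup_eq_left.1 h)

theorem al_inf_ar (S : CoveringSquare L) : S.al ⊓ S.ar = S.o :=
  S.o_al.inf_eq_of_ne S.o_ar S.al_ne_ar

theorem o_lt_t (S : CoveringSquare L) : S.o < S.t := S.o_al.lt.trans S.al_t.lt

theorem le_of_mem_wing {p q : L × L} (hp : ¬ p.2 ≤ p.1) (h : q ∈ wing p) :
    q.1 ≤ p.1 ∧ q.2 ≤ p.2 ∧ ¬ q.2 ≤ p.1 := by
  induction h with
  | refl => exact ⟨le_rfl, le_rfl, hp⟩
  | tail _ h ih =>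
    obtain ⟨T, rfl, rfl⟩ := h
    refine ⟨T.o_ar.le.trans ih.1, T.al_t.le.trans ih.2.1, fun h => ih.2.2 ?_⟩
    rw [← T.al_sup_ar]
    exact sup_le h ih.1

/-- Here `x ⊓ S.o = y`, so semimodularity makes `x ⊔ S.o` a cover of `S.o`. -/
theorem sup_o_eq [IsUpperModularLattice L] (hL : AtMostTwoCovers L) (S : CoveringSquare L) {x y : L} (hyx : y ⋖ x)
    (hy : y ≤ S.o) (hx : ¬ x ≤ S.o) : x ⊔ S.o = S.al ∨ x ⊔ S.o = S.ar := by
  have h : x ⊓ S.o = y := (hyx.eq_or_eq (le_inf hyx.le hy) inf_le_left).resolve_right fun h =>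
    hx (inf_eq_left.1 h)
  have hc : S.o ⋖ x ⊔ S.o := covBy_sup_of_inf_covBy_left (h.symm ▸ hyx)
  rcases hL _ _ _ _ S.o_al S.o_ar hc with h | h | h
  · exact absurd h S.al_ne_ar
  · exact Or.inl h.symm
  · exact Or.inr h.symm

theorem not_le_of_inf_covBy {o x : L} (h : o ⊓ x ⋖ x) : ¬ x ≤ o := fun hx =>
  h.ne (inf_eq_right.2 hx)

theorem covBy_sup_inf_sup [IsUpperModularLattice L] {o x y : L} (h : o ⊓ x ⋖ x) :
    o ⊓ (x ⊔ y) ⋖ x ⊔ o ⊓ (x ⊔ y) := by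
  apply covBy_sup_of_inf_covBy_left
  rwa [← inf_assoc, inf_comm x o, inf_assoc, inf_sup_self]

/-- The upper ends of the intervals of `L` that represent elements of `L[S]` which are new or below
`o`. -/
def IsForkTop (S : CoveringSquare L) (x : L) : Prop := x ≤ S.o ∨ S.o ⊓ x ⋖ x ∨ x = S.t

theorem IsForkTop.le_t [IsUpperModularLattice L] (hL : AtMostTwoCovers L) {S : CoveringSquare L} {x : L}
    (h : S.IsForkTop x) : x ≤ S.t := by
  rcases h with h | h | rfl
  · exact h.trans S.o_lt_t.le
  · rcases S.sup_o_eq hL h inf_le_left (not_le_of_inf_covBy h) with h' | h'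
    · exact (le_sup_left.trans h'.le).trans S.al_t.le
    · exact (le_sup_left.trans h'.le).trans S.ar_t.le
  · exact le_rfl

namespace Fork

variable {S : CoveringSquare L}

theorem gen_wing {p q : S.wings} (h : q.1 ∈ wing p.1) :
    Relation.ReflTransGen Gen (z q) (z p) := by
  obtain ⟨q, hq⟩ := q
  change q ∈ wing p.1 at h
  induction h with
  | refl => exact Relation.ReflTransGen.refl
  | @tail r s hr hs ih =>
    have hrw : r ∈ S.wings := by
      rcases p.2 with h | h
      exacts [Or.inl (Relation.ReflTransGen.trans h hr), Or.inr (Relation.ReflTransGen.trans h hr)]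
    exact Relation.ReflTransGen.head (Gen.step ⟨r, hrw⟩ ⟨s, hq⟩ hs) (ih hrw)

theorem gen_z_m (p : S.wings) : Relation.ReflTransGen Gen (z p) m := by
  rcases p.2 with h | h
  · exact (gen_wing (p := ⟨(S.o, S.al), Or.inl Relation.ReflTransGen.refl⟩) h).tail Gen.left
  · exact (gen_wing (p := ⟨(S.o, S.ar), Or.inr Relation.ReflTransGen.refl⟩) h).tail Gen.right

theorem bounds_fst_le (a : Fork S) : (bounds a).1 ≤ (bounds a).2 := by
  cases a with
  | old x => exact le_rfl
  | z p => exact (wings_covBy p).le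
  | m => exact S.o_lt_t.le

end Fork

section Semimodular

variable [Finite L] [IsUpperModularLattice L]

/-- In a finite semimodular lattice every prime interval that is perspective up to the prime
interval `[b, x ⊔ b]` belongs to its wing. -/
theorem mem_wing_of_le {x y b : L} (hyx : y ⋖ x) (hyb : y ≤ b) (hxb : ¬ x ≤ b) :
    (y, x) ∈ wing (b, x ⊔ b) := by
  induction y using WellFoundedGT.induction generalizing x with
  | ind y ih =>
    rcases hyb.eq_or_lt with rfl | hlt
    · rw [sup_eq_left.2 hyx.le]
      exact Relation.ReflTransGen.refl
    -- Semimodularity makes `y, x, y', x ⊔ y'` a covering square, so `(y, x)` is one step below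
    -- `(y', x ⊔ y')`, which is handled by induction.
    · obtain ⟨y', hy', hyb'⟩ := exists_covBy_le_of_lt hlt
      have hne : x ≠ y' := by rintro rfl; exact hxb hyb'
      have h1 : y' ⋖ x ⊔ y' := hyx.covBy_sup_of_ne hy' hne
      have h2 : x ⋖ x ⊔ y' := sup_comm y' x ▸ hy'.covBy_sup_of_ne hyx hne.symm
      have := ih y' hy'.lt h1 hyb' fun h => hxb (le_sup_left.trans h)
      rw [sup_assoc, sup_eq_right.2 hyb'] at this
      exact Relation.ReflTransGen.tail this ⟨⟨y, x, y', x ⊔ y', hne, hyx, hy', h2, h1⟩, rfl, rfl⟩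

theorem mem_wings_iff (hL : AtMostTwoCovers L) (S : CoveringSquare L) {p : L × L} :
    p ∈ S.wings ↔ p.1 ⋖ p.2 ∧ p.1 ≤ S.o ∧ ¬ p.2 ≤ S.o := by
  constructor
  · intro h
    refine ⟨Fork.wings_covBy ⟨p, h⟩, ?_⟩
    rcases h with h | h
    · have := le_of_mem_wing S.o_al.lt.not_ge h
      exact ⟨this.1, this.2.2⟩
    · have := le_of_mem_wing S.o_ar.lt.not_ge h
      exact ⟨this.1, this.2.2⟩
  · rintro ⟨h, h1, h2⟩
    have hw := mem_wing_of_le h h1 h2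
    rcases S.sup_o_eq hL h h1 h2 with h' | h' <;> rw [h'] at hw
    exacts [Or.inl hw, Or.inr hw]

theorem IsForkTop.sup (hL : AtMostTwoCovers L) {S : CoveringSquare L} {x y : L}
    (hx : S.IsForkTop x) (hy : S.IsForkTop y) : S.IsForkTop (x ⊔ y) := by
  have hxt := hx.le_t hL
  have hyt := hy.le_t hL
  have aux : ∀ {x y : L}, S.o ⊓ x ⋖ x → y ≤ S.o → S.IsForkTop (x ⊔ y) := by
    intro x y hx hy
    have h := covBy_sup_inf_sup (y := y) hx
    have he : x ⊔ S.o ⊓ (x ⊔ y) = x ⊔ y :=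
      le_antisymm (sup_le le_sup_left inf_le_right) (sup_le_sup_left (le_inf hy le_sup_right) _)
    rw [he] at h
    exact Or.inr (Or.inl h)
  rcases hx with hx | hx | rfl
  · rcases hy with hy | hy | rfl
    · exact Or.inl (sup_le hx hy)
    · exact sup_comm y x ▸ aux hy hx
    · exact Or.inr (Or.inr (sup_eq_right.2 hxt))
  · rcases hy with hy | hy | rfl
    · exact aux hx hy
    · have h1 := covBy_sup_inf_sup (y := y) hx
      have h2 := covBy_sup_inf_sup (y := x) hy
      rw [sup_comm y x] at h2
      -- Put v = o ⊓ (x ⊔ y); both sides cover v. If they agree, they equal x ⊔ y. If they differ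
      -- and v = o, they are the two middle elements of S and x ⊔ y = t. If they differ and v < o, a
      -- cover of v inside the ideal of o would be a third one.
      by_cases he : x ⊔ S.o ⊓ (x ⊔ y) = y ⊔ S.o ⊓ (x ⊔ y)
      · have : x ⊔ S.o ⊓ (x ⊔ y) = x ⊔ y :=
          le_antisymm (sup_le le_sup_left inf_le_right)
            (sup_le le_sup_left (he ▸ le_sup_left))
        rw [this] at h1
        exact Or.inr (Or.inl h1)
      · rcases (inf_le_left : S.o ⊓ (x ⊔ y) ≤ S.o).eq_or_lt with hv | hv
        · rw [hv] at he
          refine Or.inr (Or.inr (le_antisymm (sup_le hxt hyt) ?_))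
          have ho : S.o ≤ x ⊔ y := inf_eq_left.1 hv
          have hx' : x ⊔ S.o ≤ x ⊔ y := sup_le le_sup_left ho
          have hy' : y ⊔ S.o ≤ x ⊔ y := sup_le le_sup_right ho
          rw [← S.al_sup_ar]
          rcases S.sup_o_eq hL hx inf_le_left (not_le_of_inf_covBy hx) with h3 | h3 <;>
          rcases S.sup_o_eq hL hy inf_le_left (not_le_of_inf_covBy hy) with h4 | h4
          · exact absurd (h3.trans h4.symm) he
          · exact sup_le (h3 ▸ hx') (h4 ▸ hy')
          · exact sup_le (h4 ▸ hy') (h3 ▸ hx')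
          · exact absurd (h3.trans h4.symm) he
        · obtain ⟨k, hk, hko⟩ := exists_covBy_le_of_lt hv
          rcases hL _ _ _ _ h1 h2 hk with h | h | h
          · exact absurd h he
          · exact absurd ((le_sup_left.trans h.le).trans hko) (not_le_of_inf_covBy hx)
          · exact absurd ((le_sup_left.trans h.le).trans hko) (not_le_of_inf_covBy hy)
    · exact Or.inr (Or.inr (sup_eq_right.2 hxt))
  · exact Or.inr (Or.inr (sup_eq_left.2 hyt))

/-- Closure under joins turns a maximal fork top below `h` into the greatest; `S.o ⊓ h` shows that
there is one. -/
theorem exists_isGreatest_isForkTop (hL : AtMostTwoCovers L) (S : CoveringSquare L) (h : L) :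
    ∃ g, IsGreatest {k | S.IsForkTop k ∧ k ≤ h} g := by
  obtain ⟨g, hg⟩ := (Set.toFinite {k | S.IsForkTop k ∧ k ≤ h}).exists_maximal
    ⟨S.o ⊓ h, Or.inl inf_le_left, inf_le_right⟩
  exact ⟨g, hg.prop, fun k hk => le_sup_right.trans
    (hg.2 ⟨hg.prop.1.sup hL hk.1, sup_le hg.prop.2 hk.2⟩ le_sup_left)⟩

/-! ### The order and the lattice operations of the fork extension. -/

namespace Fork

variable {S : CoveringSquare L}

/-- The order of `L[S]` is the componentwise order of the intervals that represent its elements. -/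
theorem order_le_iff (hL : AtMostTwoCovers L) {a b : Fork S} :
    (order S).le a b ↔ bounds a ≤ bounds b := by
  refine ⟨bounds_mono, fun h => ?_⟩
  change Relation.ReflTransGen Gen a b
  have hold : ∀ {x y : L}, x ≤ y → Relation.ReflTransGen Gen (old (S := S) x) (old y) :=
    fun h => Relation.ReflTransGen.single (Gen.old h)
  cases a with
  | old x =>
    cases b with
    | old y => exact hold h.1
    | z p => exact (hold h.1).tail (Gen.lower p)
    | m =>
      let p : S.wings := ⟨(S.o, S.al), Or.inl Relation.ReflTransGen.refl⟩
      exact ((hold h.1).tail (Gen.lower p)).trans (gen_z_m p)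
  | z p =>
    cases b with
    | old y => exact Relation.ReflTransGen.head (Gen.upper p) (hold h.2)
    | z q =>
      -- The interval of `q` is `[q.1.1, p.1.2 ⊔ q.1.1]`, so `p` is perspective up to it.
      apply gen_wing
      obtain ⟨hp, hp1, hp2⟩ := (mem_wings_iff hL S).1 p.2
      obtain ⟨hq, hq1, hq2⟩ := (mem_wings_iff hL S).1 q.2
      have hn : ¬ p.1.2 ≤ q.1.1 := fun h => hp2 (h.trans hq1)
      have hw := mem_wing_of_le hp h.1 hn
      have he : p.1.2 ⊔ q.1.1 = q.1.2 :=
        (hq.eq_or_eq le_sup_right (sup_le h.2 hq.le)).resolve_left fun h =>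
          hn (sup_eq_right.1 h)
      change p.1 ∈ wing (q.1.1, p.1.2 ⊔ q.1.1) at hw
      rwa [he] at hw
    | m => exact gen_z_m p
  | m =>
    cases b with
    | old y => exact Relation.ReflTransGen.head Gen.top (hold h.2)
    | z p =>
      obtain ⟨hp, hp1, hp2⟩ := (mem_wings_iff hL S).1 p.2
      have : p.1.1 = S.o := le_antisymm hp1 h.1
      exact absurd (S.al_t.lt.trans_le h.2) (hp.2 (this ▸ S.o_al.lt))
    | m => exact Relation.ReflTransGen.refl

/-- A new element is determined by its upper end, which reduces joins and meets to computations with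
fork tops. -/
theorem bounds_cases (hL : AtMostTwoCovers L) (a : Fork S) :
    (bounds a).1 = (bounds a).2 ∨
      (bounds a).1 = S.o ⊓ (bounds a).2 ∧ S.IsForkTop (bounds a).2 := by
  cases a with
  | old x => exact Or.inl rfl
  | z p =>
    obtain ⟨hp, hp1, hp2⟩ := (mem_wings_iff hL S).1 p.2
    have : S.o ⊓ p.1.2 = p.1.1 :=
      (hp.eq_or_eq (le_inf hp1 hp.le) inf_le_right).resolve_right fun h => hp2 (inf_eq_right.1 h)
    exact Or.inr ⟨this.symm, Or.inr (Or.inl (by rw [bounds, this]; exact hp))⟩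
  | m => exact Or.inr ⟨(inf_eq_left.2 S.o_lt_t.le).symm, Or.inr (Or.inr rfl)⟩

theorem exists_bounds_eq (hL : AtMostTwoCovers L) {h : L} (hh : S.IsForkTop h) :
    ∃ a : Fork S, bounds a = (S.o ⊓ h, h) := by
  rcases hh with hh | hh | rfl
  · exact ⟨old h, by rw [inf_eq_right.2 hh]; rfl⟩
  · exact ⟨z ⟨(S.o ⊓ h, h), (mem_wings_iff hL S).2 ⟨hh, inf_le_left, not_le_of_inf_covBy hh⟩⟩, rfl⟩
  · exact ⟨m, by rw [inf_eq_left.2 S.o_lt_t.le]; rfl⟩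

theorem isForkTop_of_fst_le (hL : AtMostTwoCovers L) {a : Fork S} (h : (bounds a).1 ≤ S.o) :
    S.IsForkTop (bounds a).2 := by
  rcases bounds_cases hL a with h' | h'
  · exact Or.inl (h' ▸ h)
  · exact h'.2

theorem fst_le_o (hL : AtMostTwoCovers L) {a : Fork S} (h : (bounds a).1 ≠ (bounds a).2) :
    (bounds a).1 = S.o ⊓ (bounds a).2 := ((bounds_cases hL a).resolve_left h).1

/-- An upper bound of elements whose lower ends are not both below `S.o` must be old, so there the
join is old. Otherwise both upper ends are fork tops, and so is their join. -/
theorem exists_sup (hL : AtMostTwoCovers L) (a b : Fork S) :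
    ∃ c : Fork S, (bounds c).2 = (bounds a).2 ⊔ (bounds b).2 ∧
      ((bounds a).1 ⊔ (bounds b).1 ≤ S.o →
        (bounds c).1 = S.o ⊓ ((bounds a).2 ⊔ (bounds b).2)) ∧
      (¬ (bounds a).1 ⊔ (bounds b).1 ≤ S.o → (bounds c).1 = (bounds a).2 ⊔ (bounds b).2) := by
  by_cases h : (bounds a).1 ⊔ (bounds b).1 ≤ S.o
  · obtain ⟨c, hc⟩ := exists_bounds_eq hL ((isForkTop_of_fst_le hL (le_sup_left.trans h)).sup hL
      (isForkTop_of_fst_le hL (le_sup_right.trans h)))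
    exact ⟨c, by rw [hc], fun _ => by rw [hc], fun h' => absurd h h'⟩
  · exact ⟨old ((bounds a).2 ⊔ (bounds b).2), rfl, fun h' => absurd h' h, fun _ => rfl⟩

/-- A lower bound of a new element has its lower end below `S.o`, hence a fork top as upper end; the
meet takes the greatest available one. -/
theorem exists_inf (hL : AtMostTwoCovers L) (a b : Fork S) :
    ∃ c : Fork S, (bounds c).1 = (bounds a).1 ⊓ (bounds b).1 ∧
      ((bounds a).1 = (bounds a).2 ∧ (bounds b).1 = (bounds b).2 →
        (bounds c).2 = (bounds a).2 ⊓ (bounds b).2) ∧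
      (¬ ((bounds a).1 = (bounds a).2 ∧ (bounds b).1 = (bounds b).2) →
        IsGreatest {k | S.IsForkTop k ∧ k ≤ (bounds a).2 ⊓ (bounds b).2} (bounds c).2) := by
  by_cases h : (bounds a).1 = (bounds a).2 ∧ (bounds b).1 = (bounds b).2
  · refine ⟨old ((bounds a).2 ⊓ (bounds b).2), ?_, fun _ => rfl, fun h' => absurd h h'⟩
    rw [h.1, h.2]
    rfl
  · obtain ⟨g, hg⟩ := exists_isGreatest_isForkTop hL S ((bounds a).2 ⊓ (bounds b).2)
    obtain ⟨c, hc⟩ := exists_bounds_eq hL hg.1.1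
    refine ⟨c, ?_, fun h' => absurd h' h, fun _ => hc ▸ hg⟩
    have h1 : S.o ⊓ g = S.o ⊓ ((bounds a).2 ⊓ (bounds b).2) :=
      le_antisymm (inf_le_inf_left _ hg.1.2)
        (le_inf inf_le_left (hg.2 ⟨Or.inl inf_le_left, inf_le_right⟩))
    rw [hc, h1]
    by_cases ha : (bounds a).1 = (bounds a).2
    · rw [ha, fst_le_o hL fun hb => h ⟨ha, hb⟩, inf_left_comm]
    · rw [fst_le_o hL ha]
      by_cases hb : (bounds b).1 = (bounds b).2
      · rw [hb, inf_assoc]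
      · rw [fst_le_o hL hb, inf_inf_inf_comm, inf_idem]

/-- The lattice operations of `L[S]`. -/
@[reducible]
noncomputable def lattice (hL : AtMostTwoCovers L) (S : CoveringSquare L) : Lattice (Fork S) where
  __ := order S
  sup a b := (exists_sup hL a b).choose
  inf a b := (exists_inf hL a b).choose
  le_sup_left a b := by
    obtain ⟨h, h1, h2⟩ := (exists_sup hL a b).choose_spec
    refine (order_le_iff hL).2 ⟨?_, le_sup_left.trans h.ge⟩
    by_cases ho : (bounds a).1 ⊔ (bounds b).1 ≤ S.o
    · exact (le_inf (le_sup_left.trans ho) ((bounds_fst_le a).trans le_sup_left)).trans (h1 ho).ge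
    · exact ((bounds_fst_le a).trans le_sup_left).trans (h2 ho).ge
  le_sup_right a b := by
    obtain ⟨h, h1, h2⟩ := (exists_sup hL a b).choose_spec
    refine (order_le_iff hL).2 ⟨?_, le_sup_right.trans h.ge⟩
    by_cases ho : (bounds a).1 ⊔ (bounds b).1 ≤ S.o
    · exact (le_inf (le_sup_right.trans ho) ((bounds_fst_le b).trans le_sup_right)).trans (h1 ho).ge
    · exact ((bounds_fst_le b).trans le_sup_right).trans (h2 ho).ge
  sup_le a b c hac hbc := by
    obtain ⟨h, h1, h2⟩ := (exists_sup hL a b).choose_spec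
    have hac' := (order_le_iff hL).1 hac
    have hbc' := (order_le_iff hL).1 hbc
    have h3 := sup_le hac'.2 hbc'.2
    refine (order_le_iff hL).2 ⟨?_, h.le.trans h3⟩
    by_cases ho : (bounds a).1 ⊔ (bounds b).1 ≤ S.o
    · rw [h1 ho]
      rcases bounds_cases hL c with hc | hc
      · exact inf_le_right.trans (h3.trans hc.ge)
      · exact hc.1 ▸ inf_le_inf_left _ h3
    · rw [h2 ho]
      rcases bounds_cases hL c with hc | hc
      · exact h3.trans hc.ge
      · exact absurd (sup_le (hac'.1.trans (hc.1.trans_le inf_le_left))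
          (hbc'.1.trans (hc.1.trans_le inf_le_left))) ho
  inf_le_left a b := by
    obtain ⟨h, h1, h2⟩ := (exists_inf hL a b).choose_spec
    refine (order_le_iff hL).2 ⟨h.le.trans inf_le_left, ?_⟩
    by_cases ho : (bounds a).1 = (bounds a).2 ∧ (bounds b).1 = (bounds b).2
    · exact (h1 ho).le.trans inf_le_left
    · exact (h2 ho).1.2.trans inf_le_left
  inf_le_right a b := by
    obtain ⟨h, h1, h2⟩ := (exists_inf hL a b).choose_spec
    refine (order_le_iff hL).2 ⟨h.le.trans inf_le_right, ?_⟩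
    by_cases ho : (bounds a).1 = (bounds a).2 ∧ (bounds b).1 = (bounds b).2
    · exact (h1 ho).le.trans inf_le_right
    · exact (h2 ho).1.2.trans inf_le_right
  le_inf c a b hca hcb := by
    obtain ⟨h, h1, h2⟩ := (exists_inf hL a b).choose_spec
    have hca' := (order_le_iff hL).1 hca
    have hcb' := (order_le_iff hL).1 hcb
    have h3 := le_inf hca'.2 hcb'.2
    refine (order_le_iff hL).2 ⟨(le_inf hca'.1 hcb'.1).trans h.ge, ?_⟩
    by_cases ho : (bounds a).1 = (bounds a).2 ∧ (bounds b).1 = (bounds b).2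
    · exact h3.trans (h1 ho).ge
    · refine (h2 ho).2 ⟨isForkTop_of_fst_le hL ?_, h3⟩
      by_cases ha : (bounds a).1 = (bounds a).2
      · exact hcb'.1.trans ((fst_le_o hL fun hb => ho ⟨ha, hb⟩).trans_le inf_le_left)
      · exact hca'.1.trans ((fst_le_o hL ha).trans_le inf_le_left)

end Fork

/-- The fork extension as a lattice extension. -/
noncomputable def forkLattice (hL : AtMostTwoCovers L) (S : CoveringSquare L) : S.ForkLattice where
  lattice := Fork.lattice hL S
  order_eq := rfl
  incl :=
    letI := Fork.lattice hL S
    { toFun := Fork.old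
      map_sup' := fun x y => by
        obtain ⟨h, h1, h2⟩ := (Fork.exists_sup hL (Fork.old (S := S) x) (Fork.old y)).choose_spec
        refine Fork.bounds_injective (Prod.ext ?_ h.symm)
        by_cases ho : x ⊔ y ≤ S.o
        · exact ((h1 ho).trans (inf_eq_right.2 ho)).symm
        · exact (h2 ho).symm
      map_inf' := fun x y => by
        obtain ⟨h, h1, -⟩ := (Fork.exists_inf hL (Fork.old (S := S) x) (Fork.old y)).choose_spec
        exact Fork.bounds_injective (Prod.ext h.symm (h1 ⟨rfl, rfl⟩).symm) }
  incl_eq _ := rfl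

end Semimodular

/-! ### Extending congruences -/

variable {α : LatticeCon L} {S : CoveringSquare L}

section Zero

variable [Finite L]

/-- Otherwise α collapses `S.o` with `y ⊔ S.o`, hence with a cover of `S.o` in between, which is a
side of the square. -/
theorem RestrictsToZero.le_o (hα : S.RestrictsToZero α) (hL : AtMostTwoCovers L) {x y : L}
    (h : α.r x y) (hx : x ≤ S.o) : y ≤ S.o := by
  have h1 : α.r S.o (y ⊔ S.o) := by simpa [sup_eq_right.2 hx] using α.sup h (α.iseqv.refl S.o)
  by_contra hy
  obtain ⟨k, hk, hky⟩ := exists_covBy_le_of_lt (lt_of_le_of_ne le_sup_right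
    fun h => hy (sup_eq_right.1 h.symm) : S.o < y ⊔ S.o)
  have h2 : α.r S.o k := by
    simpa [inf_eq_left.2 hk.le, inf_eq_right.2 hky] using α.inf h1 (α.iseqv.refl k)
  have hc : k ∈ S.carrier := by
    rcases hL _ _ _ _ S.o_al S.o_ar hk with h | h | h
    · exact absurd h S.al_ne_ar
    · exact h ▸ Or.inr (Or.inl rfl)
    · exact h ▸ Or.inr (Or.inr (Or.inl rfl))
  exact hk.ne (hα _ (Or.inl rfl) _ hc h2)

theorem RestrictsToZero.le_o_of_inf (hα : S.RestrictsToZero α) (hL : AtMostTwoCovers L) {x : L}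
    (h : α.r (S.o ⊓ x) x) : x ≤ S.o :=
  hα.le_o hL h inf_le_left

theorem RestrictsToZero.eq_t (hα : S.RestrictsToZero α) (hL : AtMostTwoCovers L) {u : L}
    (h : α.r u S.t) (hu : u ≤ S.t) : u = S.t := by
  have aux : ∀ b, ¬ b ≤ S.o → b ≤ S.t → S.o ≤ b →
      ¬ u ⊓ b ≤ S.o ∧ ∃ k, S.o ⊓ u ⋖ k ∧ k ≤ u ⊓ b ∧ ¬ k ≤ S.o := by
    intro b hb hbt hob
    have h1 : α.r (u ⊓ b) b := by simpa [inf_eq_right.2 hbt] using α.inf h (α.iseqv.refl b)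
    have h2 : ¬ u ⊓ b ≤ S.o := fun h => hb (hα.le_o hL h1 h)
    have h3 : S.o ⊓ u ≤ u ⊓ b := le_inf inf_le_right (inf_le_left.trans hob)
    obtain ⟨k, hk, hkb⟩ := exists_covBy_le_of_lt (lt_of_le_of_ne h3
      fun h => h2 (h ▸ inf_le_left))
    exact ⟨h2, k, hk, hkb, fun h => hk.lt.not_ge (le_inf h (hkb.trans inf_le_left))⟩
  obtain ⟨n1, k1, hk1, h1, h1'⟩ := aux S.al S.o_al.lt.not_ge S.al_t.le S.o_al.le
  obtain ⟨n2, k2, hk2, h2, h2'⟩ := aux S.ar S.o_ar.lt.not_ge S.ar_t.le S.o_ar.le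
  -- If o ≤ u, then u contains both middle elements of S. If not, o ⊓ u has a cover below o besides
  -- `k1` and `k2`, and these two are distinct since a common value would lie below al ⊓ ar = o.
  rcases (inf_le_left : S.o ⊓ u ≤ S.o).eq_or_lt with hv | hv
  · have hou : S.o ≤ u := inf_eq_left.1 hv
    have e1 := (S.o_al.eq_or_eq (le_inf hou S.o_al.le) inf_le_right).resolve_left fun h => n1 h.le
    have e2 := (S.o_ar.eq_or_eq (le_inf hou S.o_ar.le) inf_le_right).resolve_left fun h => n2 h.le
    refine le_antisymm hu ?_
    rw [← S.al_sup_ar]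
    exact sup_le (inf_eq_right.1 e1) (inf_eq_right.1 e2)
  · obtain ⟨k, hk, hko⟩ := exists_covBy_le_of_lt hv
    rcases hL _ _ _ _ hk1 hk2 hk with rfl | rfl | rfl
    · refine absurd ?_ h1'
      rw [← S.al_inf_ar]
      exact le_inf (h1.trans inf_le_right) (h2.trans inf_le_right)
    · exact absurd hko h1'
    · exact absurd hko h2'

theorem RestrictsToZero.exists_isForkTop [IsUpperModularLattice L] (hα : S.RestrictsToZero α)
    (hL : AtMostTwoCovers L) {h h' w : L} (hh : α.r h h') (hw : S.IsForkTop w) (hwh : w ≤ h') :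
    ∃ k, S.IsForkTop k ∧ k ≤ h ∧ α.r k w := by
  have h1 : α.r (h ⊓ w) w := by simpa [inf_eq_right.2 hwh] using α.inf hh (α.iseqv.refl w)
  rcases hw with hw | hw | rfl
  · exact ⟨h ⊓ w, Or.inl (inf_le_right.trans hw), inf_le_left, h1⟩
  · have hn := not_le_of_inf_covBy hw
    have hn' : ¬ h ⊓ w ≤ S.o := fun h => hn (hα.le_o hL h1 h)
    have h2 : α.r (S.o ⊓ (h ⊓ w)) (S.o ⊓ w) := α.inf (α.iseqv.refl _) h1
    -- Replacing `S.o ⊓ (h ⊓ w)` by the congruent `S.o ⊓ w` and joining with `k` gives `w`, so `k`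
    -- is congruent to `w`.
    obtain ⟨k, hk, hkw⟩ := exists_covBy_le_of_lt (lt_of_le_of_ne inf_le_right
      fun h => hn' (inf_eq_right.1 h) : S.o ⊓ (h ⊓ w) < h ⊓ w)
    have hko : ¬ k ≤ S.o := fun h => hk.lt.not_ge (le_inf h hkw)
    have he : S.o ⊓ k = S.o ⊓ (h ⊓ w) :=
      le_antisymm (inf_le_inf_left _ hkw) (le_inf inf_le_left hk.le)
    refine ⟨k, Or.inr (Or.inl (he ▸ hk)), hkw.trans inf_le_left, ?_⟩
    have h3 : S.o ⊓ w ⊔ k = w :=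
      (hw.eq_or_eq le_sup_left (sup_le inf_le_right (hkw.trans inf_le_right))).resolve_left
        fun h => hko ((le_sup_right.trans h.le).trans inf_le_left)
    have h4 := α.sup h2 (α.iseqv.refl k)
    rwa [h3, sup_eq_right.2 hk.le] at h4
  · exact ⟨S.t, Or.inr (Or.inr rfl), inf_eq_right.1 (hα.eq_t hL h1 inf_le_right), α.iseqv.refl _⟩

theorem RestrictsToZero.isGreatest_congr [IsUpperModularLattice L] (hα : S.RestrictsToZero α)
    (hL : AtMostTwoCovers L) {h h' g g' : L} (hh : α.r h h')
    (hg : IsGreatest {k | S.IsForkTop k ∧ k ≤ h} g)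
    (hg' : IsGreatest {k | S.IsForkTop k ∧ k ≤ h'} g') : α.r g g' := by
  have aux : ∀ {h h' g g' : L}, α.r h h' → IsGreatest {k | S.IsForkTop k ∧ k ≤ h} g →
      IsGreatest {k | S.IsForkTop k ∧ k ≤ h'} g' → α.r g (g ⊔ g') := by
    intro h h' g g' hh hg hg'
    obtain ⟨k, hk, hkh, hkg⟩ := hα.exists_isForkTop hL hh hg'.1.1 hg'.1.2
    simpa [sup_eq_left.2 (hg.2 ⟨hk, hkh⟩)] using α.sup (α.iseqv.refl g) hkg
  have h1 := aux hh hg hg'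
  have h2 := aux (α.iseqv.symm hh) hg' hg
  rw [sup_comm] at h2
  exact α.iseqv.trans h1 (α.iseqv.symm h2)

end Zero

variable [Finite L] [IsUpperModularLattice L]

theorem RestrictsToZero.extends (hα : S.RestrictsToZero α) (hL : AtMostTwoCovers L) :
    (forkLattice hL S).Extends α := by
  let := Fork.lattice hL S
  -- Being old is invariant: a new `b` congruent to an old `a` would have its upper end h congruent
  -- to o ⊓ h, which forces h ≤ o.
  have hold : ∀ {a b : Fork S}, α.r (Fork.bounds a).1 (Fork.bounds b).1 →
      α.r (Fork.bounds a).2 (Fork.bounds b).2 → (Fork.bounds a).1 = (Fork.bounds a).2 →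
      (Fork.bounds b).1 = (Fork.bounds b).2 := by
    intro a b h1 h2 h
    by_contra hb
    have hb' := Fork.fst_le_o hL hb
    rw [h] at h1
    have h3 := α.iseqv.trans (α.iseqv.symm h1) h2
    rw [hb'] at h3 hb
    exact hb (inf_eq_right.2 (hα.le_o_of_inf hL h3))
  refine ⟨{ r := fun a b => α.r (Fork.bounds a).1 (Fork.bounds b).1 ∧
              α.r (Fork.bounds a).2 (Fork.bounds b).2
            iseqv := ⟨fun a => ⟨α.iseqv.refl _, α.iseqv.refl _⟩,
              fun h => ⟨α.iseqv.symm h.1, α.iseqv.symm h.2⟩,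
              fun h h' => ⟨α.iseqv.trans h.1 h'.1, α.iseqv.trans h.2 h'.2⟩⟩
            inf := ?_
            sup := ?_ }, fun x y => ⟨fun h => h.1, fun h => ⟨h, h⟩⟩⟩
  · rintro a b c d ⟨h1, h2⟩ ⟨h3, h4⟩
    obtain ⟨e, e1, e2⟩ := (Fork.exists_inf hL a c).choose_spec
    obtain ⟨f, f1, f2⟩ := (Fork.exists_inf hL b d).choose_spec
    constructor
    · exact e ▸ f ▸ α.inf h1 h3
    · by_cases ho : (Fork.bounds a).1 = (Fork.bounds a).2 ∧ (Fork.bounds c).1 = (Fork.bounds c).2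
      · exact e1 ho ▸ f1 ⟨hold h1 h2 ho.1, hold h3 h4 ho.2⟩ ▸ α.inf h2 h4
      · refine hα.isGreatest_congr hL (α.inf h2 h4) (e2 ho) (f2 fun ho' => ho ?_)
        exact ⟨hold (α.iseqv.symm h1) (α.iseqv.symm h2) ho'.1,
          hold (α.iseqv.symm h3) (α.iseqv.symm h4) ho'.2⟩
  · rintro a b c d ⟨h1, h2⟩ ⟨h3, h4⟩
    obtain ⟨e, e1, e2⟩ := (Fork.exists_sup hL a c).choose_spec
    obtain ⟨f, f1, f2⟩ := (Fork.exists_sup hL b d).choose_spec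
    have h5 := α.sup h2 h4
    constructor
    · by_cases ho : (Fork.bounds a).1 ⊔ (Fork.bounds c).1 ≤ S.o
      · exact e1 ho ▸ f1 (hα.le_o hL (α.sup h1 h3) ho) ▸ α.inf (α.iseqv.refl _) h5
      · exact e2 ho ▸ f2 (fun h => ho (hα.le_o hL (α.iseqv.symm (α.sup h1 h3)) h)) ▸ h5
    · exact e ▸ f ▸ h5

theorem RestrictsToOne.extends (hα : S.RestrictsToOne α) (hL : AtMostTwoCovers L) :
    (forkLattice hL S).Extends α := by
  let := Fork.lattice hL S
  have hot : α.r S.o S.t := hα _ (Or.inl rfl) _ (Or.inr (Or.inr (Or.inr rfl)))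
  -- The interval of a new element is [o, t] met with its upper end. Lower ends can thus serve for
  -- meets and upper ends for joins.
  have key : ∀ a : Fork S, α.r (Fork.bounds a).1 (Fork.bounds a).2 := by
    intro a
    by_cases h : (Fork.bounds a).1 = (Fork.bounds a).2
    · rw [h]
    · have h1 := Fork.fst_le_o hL h
      have h2 := ((Fork.bounds_cases hL a).resolve_left h).2.le_t hL
      have h3 := α.inf hot (α.iseqv.refl (Fork.bounds a).2)
      rwa [inf_eq_right.2 h2, ← h1] at h3
  have key' : ∀ a b : Fork S, α.r (Fork.bounds a).1 (Fork.bounds b).1 ↔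
      α.r (Fork.bounds a).2 (Fork.bounds b).2 := fun a b =>
    ⟨fun h => α.iseqv.trans (α.iseqv.symm (key a)) (α.iseqv.trans h (key b)),
      fun h => α.iseqv.trans (key a) (α.iseqv.trans h (α.iseqv.symm (key b)))⟩
  refine ⟨{ r := fun a b => α.r (Fork.bounds a).1 (Fork.bounds b).1
            iseqv := ⟨fun a => α.iseqv.refl _, fun h => α.iseqv.symm h,
              fun h h' => α.iseqv.trans h h'⟩
            inf := ?_
            sup := ?_ }, fun x y => Iff.rfl⟩
  · intro a b c d h1 h2
    have e := (Fork.exists_inf hL a c).choose_spec.1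
    have f := (Fork.exists_inf hL b d).choose_spec.1
    exact e ▸ f ▸ α.inf h1 h2
  · intro a b c d h1 h2
    have e := (Fork.exists_sup hL a c).choose_spec.1
    have f := (Fork.exists_sup hL b d).choose_spec.1
    exact (key' _ _).2 (e ▸ f ▸ α.sup ((key' _ _).1 h1) ((key' _ _).1 h2))

end

end CoveringSquare

/-! ### Planar diagrams with integer coordinates -/

section Segment

variable {F : ℝ × ℝ →ₗ[ℝ] ℝ} {A B p : ℝ × ℝ}

theorem map_le_of_mem_segment (hp : p ∈ segment ℝ A B) {k : ℝ} (hA : F A ≤ k) (hB : F B ≤ k) :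
    F p ≤ k := by
  obtain ⟨s, t, hs, ht, hst, rfl⟩ := hp
  simp only [map_add, map_smul, smul_eq_mul]
  calc s * F A + t * F B ≤ s * k + t * k := by gcongr
    _ = k := by rw [← add_mul, hst, one_mul]

theorem lt_map_of_mem_segment (hp : p ∈ segment ℝ A B) {k : ℝ} (hA : k < F A) (hB : k < F B) :
    k < F p := by
  obtain ⟨s, t, hs, ht, hst, rfl⟩ := hp
  simp only [map_add, map_smul, smul_eq_mul]
  have : k = s * k + t * k := by rw [← add_mul, hst, one_mul]
  rcases hs.eq_or_lt with rfl | hs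
  · obtain rfl : t = 1 := by linarith
    linarith
  · have h1 := mul_lt_mul_of_pos_left hA hs
    have h2 := mul_le_mul_of_nonneg_left hB.le ht
    linarith

theorem eq_of_mem_segment (hp : p ∈ segment ℝ A B) (h : F A < F B) (hB : F B ≤ F p) : p = B := by
  obtain ⟨s, t, hs, ht, hst, rfl⟩ := hp
  simp only [map_add, map_smul, smul_eq_mul] at hB
  obtain rfl : t = 1 - s := by linarith
  have : s = 0 := by nlinarith
  subst this
  simp

end Segment

/-- The values of the integer linear form `(u, v)` on the ends of an edge `a, b` are smaller than
those on the ends of the edge `c, d`, except at common ends. -/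
def SeparatesEdges {L : Type*} (X Y : L → ℤ) (u v : ℤ) (a b c d : L) : Prop :=
  (u * X a + v * Y a < u * X c + v * Y c ∨ a = c) ∧ (u * X a + v * Y a < u * X d + v * Y d ∨ a = d) ∧
  (u * X b + v * Y b < u * X c + v * Y c ∨ b = c) ∧ (u * X b + v * Y b < u * X d + v * Y d ∨ b = d)

/-- At a common point the form is at most its maximum on one edge and at least its minimum on the
other. This is possible only at a shared end, where both extremes are attained. -/
theorem SeparatesEdges.inter_subset {L : Type*} {X Y : L → ℤ} {u v : ℤ} {a b c d : L}
    (h : SeparatesEdges X Y u v a b c d) (hab : a ≠ b) (hcd : c ≠ d) {pos : L → ℝ × ℝ}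
    (hpos : ∀ x, pos x = ((X x : ℝ), (Y x : ℝ))) :
    segment ℝ (pos a) (pos b) ∩ segment ℝ (pos c) (pos d) ⊆
      pos '' (({a, b} : Set L) ∩ {c, d}) := by
  rintro p ⟨h1, h2⟩
  let F : ℝ × ℝ →ₗ[ℝ] ℝ := (u : ℝ) • LinearMap.fst ℝ ℝ ℝ + (v : ℝ) • LinearMap.snd ℝ ℝ ℝ
  have hF : ∀ {x y : L}, (u * X x + v * Y x < u * X y + v * Y y ∨ x = y) →
      F (pos x) < F (pos y) ∨ x = y := by
    intro x y h
    refine h.imp_left fun h => ?_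
    have h' : ((u * X x + v * Y x : ℤ) : ℝ) < ((u * X y + v * Y y : ℤ) : ℝ) := Int.cast_lt.2 h
    push_cast at h'
    simpa [F, hpos] using h'
  have low : ∀ {c d : L}, p ∈ segment ℝ (pos c) (pos d) → F (pos c) ≤ F (pos d) →
      F (pos c) ≤ F p := by
    intro c d hp h
    have := map_le_of_mem_segment (F := -F) (k := -F (pos c)) hp (by simp) (by simpa using h)
    simpa using this
  obtain ⟨hac, had, hbc, hbd⟩ := h
  have h1' := segment_symm ℝ (pos a) (pos b) ▸ h1
  have h2' := segment_symm ℝ (pos c) (pos d) ▸ h2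
  rcases hF hac with hac | rfl
  · rcases hF hbc with hbc | rfl
    · rcases hF had with had | rfl
      · rcases hF hbd with hbd | rfl
        · have h3 := lt_map_of_mem_segment (k := max (F (pos a)) (F (pos b))) h2 (max_lt hac hbc)
            (max_lt had hbd)
          exact absurd (map_le_of_mem_segment h1 (le_max_left _ _) (le_max_right _ _)) h3.not_ge
        · have hp := eq_of_mem_segment h1 had (low h2' hbc.le)
          exact ⟨b, by simp, hp.symm⟩
      · have hba := (hF hbd).resolve_right hab.symm
        have hp := eq_of_mem_segment h1' hba (low h2' hac.le)
        exact ⟨a, by simp, hp.symm⟩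
    · have hbd := (hF hbd).resolve_right hcd
      have hp := eq_of_mem_segment h1 hac (low h2 hbd.le)
      exact ⟨b, by simp, hp.symm⟩
  · have had := (hF had).resolve_right hcd
    have hba := (hF hbc).resolve_right hab.symm
    have hp := eq_of_mem_segment h1' hba (low h2 had.le)
    exact ⟨a, by simp, hp.symm⟩

theorem isPlanarDiagram_of_int {L : Type*} [PartialOrder L] (X Y : L → ℤ)
    (hinj : ∀ a b, X a = X b → Y a = Y b → a = b) (hup : ∀ a b, a ⋖ b → Y a < Y b)
    (hdeg : ∀ a : L, ∃ b, a ⋖ b ∨ b ⋖ a)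
    (hsep : ∀ a b c d : L, a ⋖ b → c ⋖ d → (a, b) ≠ (c, d) →
      ∃ u v : ℤ, SeparatesEdges X Y u v a b c d) :
    IsPlanarDiagram fun x : L => ((X x : ℝ), (Y x : ℝ)) := by
  have hi : Function.Injective fun x : L => ((X x : ℝ), (Y x : ℝ)) := by
    intro a b h
    simp only [Prod.mk.injEq, Int.cast_inj] at h
    exact hinj a b h.1 h.2
  have hedge : ∀ a b c d : L, a ⋖ b → c ⋖ d → (a, b) ≠ (c, d) →
      segment ℝ ((X a : ℝ), (Y a : ℝ)) ((X b : ℝ), (Y b : ℝ)) ∩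
        segment ℝ ((X c : ℝ), (Y c : ℝ)) ((X d : ℝ), (Y d : ℝ)) ⊆
        (fun x : L => ((X x : ℝ), (Y x : ℝ))) '' (({a, b} : Set L) ∩ {c, d}) := by
    intro a b c d hab hcd hne
    obtain ⟨u, v, h⟩ := hsep a b c d hab hcd hne
    exact h.inter_subset hab.ne hcd.ne (fun _ => rfl)
  refine ⟨hi, fun a b h => Int.cast_lt.2 (hup a b h), fun a b c hab hc => ?_, hedge⟩
  by_contra! hne
  -- Each vertex is an end of some edge, so a vertex on a foreign edge is a case of two meeting
  -- edges.
  obtain ⟨d, hd | hd⟩ := hdeg c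
  · obtain ⟨w, ⟨hw, -⟩, he⟩ := hedge a b c d hab hd
      (fun h => hne.1 (Prod.mk.inj h).1.symm) ⟨hc, left_mem_segment _ _ _⟩
    obtain rfl := hi he
    rcases hw with h | h
    exacts [hne.1 h, hne.2 h]
  · obtain ⟨w, ⟨hw, -⟩, he⟩ := hedge a b d c hab hd
      (fun h => hne.2 (Prod.mk.inj h).2.symm) ⟨hc, right_mem_segment _ _ _⟩
    obtain rfl := hi he
    rcases hw with h | h
    exacts [hne.1 h, hne.2 h]

/-! ### A nine-element example -/

/-- The lattice with covers `0 < 1, 2`, `1 < 3, 4`, `2 < 4, 5`, `3 < 6, 7`, `4 < 6`, `5 < 6` and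
`6, 7 < 8`: the seven-element lattice `S₇` with top `6` and a covering square `3, 7, 6, 8` attached
to one of its upper edges. -/
def GluedS7 : Type := Fin 9

namespace GluedS7

instance : DecidableEq GluedS7 := inferInstanceAs (DecidableEq (Fin 9))

instance : Fintype GluedS7 := inferInstanceAs (Fintype (Fin 9))

instance (n : ℕ) : OfNat GluedS7 n := ⟨Fin.ofNat 9 n⟩

/-- The join table. -/
def join (a b : Fin 9) : Fin 9 :=
  ![![0, 1, 2, 3, 4, 5, 6, 7, 8],
    ![1, 1, 4, 3, 4, 6, 6, 7, 8],
    ![2, 4, 2, 6, 4, 5, 6, 8, 8],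
    ![3, 3, 6, 3, 6, 6, 6, 7, 8],
    ![4, 4, 4, 6, 4, 6, 6, 8, 8],
    ![5, 6, 5, 6, 6, 5, 6, 8, 8],
    ![6, 6, 6, 6, 6, 6, 6, 8, 8],
    ![7, 7, 8, 7, 8, 8, 8, 7, 8],
    ![8, 8, 8, 8, 8, 8, 8, 8, 8]] a b

/-- The meet table. -/
def meet (a b : Fin 9) : Fin 9 :=
  ![![0, 0, 0, 0, 0, 0, 0, 0, 0],
    ![0, 1, 0, 1, 1, 0, 1, 1, 1],
    ![0, 0, 2, 0, 2, 2, 2, 0, 2],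
    ![0, 1, 0, 3, 1, 0, 3, 3, 3],
    ![0, 1, 2, 1, 4, 2, 4, 1, 4],
    ![0, 0, 2, 0, 2, 5, 5, 0, 5],
    ![0, 1, 2, 3, 4, 5, 6, 3, 6],
    ![0, 1, 0, 3, 1, 0, 3, 7, 7],
    ![0, 1, 2, 3, 4, 5, 6, 7, 8]] a b

theorem join_comm : ∀ a b, join a b = join b a := by decide

theorem join_assoc : ∀ a b c, join (join a b) c = join a (join b c) := by decide

theorem meet_comm : ∀ a b, meet a b = meet b a := by decide

theorem meet_assoc : ∀ a b c, meet (meet a b) c = meet a (meet b c) := by decide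

theorem join_meet : ∀ a b, join a (meet a b) = a := by decide

theorem meet_join : ∀ a b, meet a (join a b) = a := by decide

instance : Max GluedS7 := ⟨join⟩

instance : Min GluedS7 := ⟨meet⟩

instance : Lattice GluedS7 :=
  Lattice.mk' join_comm join_assoc meet_comm meet_assoc join_meet meet_join

instance : DecidableLE GluedS7 := fun a b => decidable_of_iff (a ⊔ b = b) sup_eq_right

instance : DecidableLT GluedS7 := fun a b => decidable_of_iff (a ≤ b ∧ ¬ b ≤ a) lt_iff_le_not_ge.symm

instance (a b : GluedS7) : Decidable (a ⋖ b) :=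
  inferInstanceAs (Decidable (a < b ∧ ∀ c, a < c → ¬ c < b))

/-- The covering pairs. -/
def edges : List (GluedS7 × GluedS7) :=
  [(0, 1), (0, 2), (1, 3), (1, 4), (2, 4), (2, 5), (3, 6), (3, 7), (4, 6), (5, 6), (6, 8), (7, 8)]

theorem mem_edges_of_covBy : ∀ a b : GluedS7, a ⋖ b → (a, b) ∈ edges := by decide

/-- The abscissas of a planar diagram. -/
def xCoord (a : GluedS7) : ℤ := ![0, -1, 1, -2, 0, 2, 0, -3, -1] (show Fin 9 from a)

/-- The ordinates of a planar diagram. -/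
def yCoord (a : GluedS7) : ℤ := ![0, 1, 1, 2, 2, 2, 4, 3, 5] (show Fin 9 from a)

/-- Linear forms that separate the edges of the diagram. -/
def directions : List (ℤ × ℤ) := [(-3, 2), (2, -1), (-2, -3), (1, 2), (-3, -2), (2, 1)]

instance (u v : ℤ) (a b c d : GluedS7) : Decidable (SeparatesEdges xCoord yCoord u v a b c d) := by
  unfold SeparatesEdges
  infer_instance

set_option maxRecDepth 10000 in
theorem exists_separatesEdges : ∀ e ∈ edges, ∀ f ∈ edges, e ≠ f → ∃ d ∈ directions,
    SeparatesEdges xCoord yCoord d.1 d.2 e.1 e.2 f.1 f.2 := by decide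

theorem isPlanarOrder : IsPlanarOrder GluedS7 := by
  refine ⟨_, isPlanarDiagram_of_int xCoord yCoord (by decide) ?_ (by decide) ?_⟩
  · have h : ∀ e ∈ edges, yCoord e.1 < yCoord e.2 := by decide
    exact fun a b hab => h _ (mem_edges_of_covBy a b hab)
  · intro a b c d hab hcd hne
    obtain ⟨f, -, hf⟩ := exists_separatesEdges _ (mem_edges_of_covBy a b hab) _
      (mem_edges_of_covBy c d hcd) hne
    exact ⟨f.1, f.2, hf⟩

theorem isSlim : IsSlim GluedS7 := by
  have key : ∀ a b c : GluedS7, a ≠ b → a ≠ c → b ≠ c → a ⊓ b = a ⊓ c → a ⊓ b = b ⊓ c →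
      a ⊔ b = a ⊔ c → a ⊔ b = b ⊔ c → False := by decide
  rintro ⟨o, a, b, c, i, hn, h1, h2, h3, h4, h5, h6⟩
  simp only [List.nodup_cons, List.mem_cons, not_or] at hn
  exact key a b c hn.2.1.1 hn.2.1.2.1 hn.2.2.1.1 (h1.trans h2.symm) (h1.trans h3.symm)
    (h4.trans h5.symm) (h4.trans h6.symm)

instance : IsUpperModularLattice GluedS7 where
  covBy_sup_of_inf_covBy := by
    have h : ∀ a b : GluedS7, a ⊓ b ⋖ a → b ⋖ a ⊔ b := by decide
    exact fun {a b} => h a b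

theorem isSPS : IsSPS GluedS7 := ⟨inferInstance, isSlim, isPlanarOrder, inferInstance⟩

/-- The attached covering square. -/
def square : CoveringSquare GluedS7 where
  o := 3
  al := 7
  ar := 6
  t := 8
  al_ne_ar := by decide
  o_al := by decide
  o_ar := by decide
  al_t := by decide
  ar_t := by decide

/-! ### Two congruences of the example, collapsing different pairs of opposite sides of the square.
-/

/-- The congruence whose classes are the principal filter of `7` and its complement. -/
def filterCon : LatticeCon GluedS7 where
  r x y := 7 ≤ x ↔ 7 ≤ y
  iseqv := ⟨fun _ => Iff.rfl, Iff.symm, Iff.trans⟩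
  inf h h' := le_inf_iff.trans ((and_congr h h').trans le_inf_iff.symm)
  sup := by
    -- `7` is join-prime, so its filter and the complement form a congruence.
    have key : ∀ x y : GluedS7, 7 ≤ x ⊔ y ↔ 7 ≤ x ∨ 7 ≤ y := by decide
    exact fun {w x y z} h h' => (key _ _).trans ((or_congr h h').trans (key _ _).symm)

/-- The least element of the class of the congruence generated by `(3, 7)`. -/
def classBot (x : GluedS7) : GluedS7 := if x = 7 then 3 else if x = 8 then 6 else x

/-- The congruence with the nontrivial classes `{3, 7}` and `{6, 8}`. -/
def edgeCon : LatticeCon GluedS7 where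
  r x y := classBot x = classBot y
  iseqv := ⟨fun _ => rfl, Eq.symm, Eq.trans⟩
  inf := by
    have key : ∀ x y : GluedS7, classBot (x ⊓ y) = classBot (classBot x ⊓ classBot y) := by decide
    exact fun {w x y z} h h' => (key _ _).trans
      ((congrArg₂ (fun a b => classBot (a ⊓ b)) h h').trans (key _ _).symm)
  sup := by
    have key : ∀ x y : GluedS7, classBot (x ⊔ y) = classBot (classBot x ⊔ classBot y) := by decide
    exact fun {w x y z} h h' => (key _ _).trans
      ((congrArg₂ (fun a b => classBot (a ⊔ b)) h h').trans (key _ _).symm)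

open CoveringSquare

/-- The element inserted into `[3, 7]` is again join-prime, and its filter meets the old lattice in
the filter of `7`. -/
theorem extends_filterCon (hL : AtMostTwoCovers GluedS7) :
    (forkLattice hL square).Extends filterCon := by
  let := Fork.lattice hL square
  let z : Fork square := Fork.z ⟨(3, 7), Or.inl Relation.ReflTransGen.refl⟩
  have hz : ∀ a : Fork square, z ≤ a ↔ 7 ≤ (Fork.bounds a).2 := by
    intro a
    refine (Fork.order_le_iff hL).trans ⟨fun h => h.2, fun h => ⟨?_, h⟩⟩
    cases a with
    | old x => exact le_trans (by decide : (3 : GluedS7) ≤ 7) h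
    | z p =>
      have key : ∀ x y : GluedS7, y ⋖ x → y ≤ 3 → 7 ≤ x → 3 ≤ y := by decide
      have hp := (mem_wings_iff hL square).1 p.2
      exact key _ _ hp.1 hp.2.1 h
    | m => exact le_rfl
  have hsup : ∀ a b : Fork square, z ≤ a ⊔ b ↔ z ≤ a ∨ z ≤ b := by
    have key : ∀ x y : GluedS7, 7 ≤ x ⊔ y → 7 ≤ x ∨ 7 ≤ y := by decide
    intro a b
    refine ⟨fun h => ?_, fun h => h.elim le_sup_of_le_left le_sup_of_le_right⟩
    rw [hz] at h ⊢
    rw [hz]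
    exact key _ _ (h.trans (Fork.exists_sup hL a b).choose_spec.1.le)
  refine ⟨{ r := fun a b => z ≤ a ↔ z ≤ b
            iseqv := ⟨fun _ => Iff.rfl, Iff.symm, Iff.trans⟩
            inf := fun h h' => le_inf_iff.trans ((and_congr h h').trans le_inf_iff.symm)
            sup := fun h h' => (hsup _ _).trans ((or_congr h h').trans (hsup _ _).symm) }, fun x y => ?_⟩
  change (z ≤ Fork.old x ↔ z ≤ Fork.old y) ↔ (7 ≤ x ↔ 7 ≤ y)
  rw [hz, hz]
  rfl

/-- Let z be inserted into `[3, 6]`. Joining 3 ≡ 7 with z gives z ≡ 8; meeting with 5 and joining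
with 2 then gives 2 ≡ 5, which `edgeCon` excludes. -/
theorem not_extends_edgeCon (hL : AtMostTwoCovers GluedS7) :
    ¬ (forkLattice hL square).Extends edgeCon := by
  let := Fork.lattice hL square
  intro h
  obtain ⟨β, hβ⟩ : ∃ β : LatticeCon (Fork square), ∀ x y : GluedS7,
    β.r (Fork.old x) (Fork.old y) ↔ edgeCon.r x y := h
  let z : Fork square := Fork.z ⟨(3, 6), Or.inr Relation.ReflTransGen.refl⟩
  have hle : ∀ {x y : GluedS7}, x ≤ y → (Fork.old x : Fork square) ≤ Fork.old y :=
    fun h => (Fork.order_le_iff hL).2 ⟨h, h⟩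
  have h1 : β.r (Fork.old 3 ⊔ z) (Fork.old 7 ⊔ z) :=
    β.sup ((hβ 3 7).2 (by decide : classBot 3 = classBot 7)) (β.iseqv.refl z)
  have e1 : Fork.old 3 ⊔ z = z :=
    sup_eq_right.2 ((Fork.order_le_iff hL).2 ⟨le_rfl, by decide⟩)
  have e2 : Fork.old 7 ⊔ z = Fork.old 8 := by
    obtain ⟨d1, -, d2⟩ := (Fork.exists_sup hL (Fork.old 7) z).choose_spec
    exact Fork.bounds_injective (Prod.ext (d2 (by decide)) d1)
  rw [e1, e2] at h1
  have h2 : β.r ((z ⊓ Fork.old 5) ⊔ Fork.old 2) ((Fork.old 8 ⊓ Fork.old 5) ⊔ Fork.old 2) :=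
    β.sup (β.inf h1 (β.iseqv.refl (Fork.old 5))) (β.iseqv.refl (Fork.old 2))
  have e3 : (z ⊓ Fork.old 5) ⊔ Fork.old 2 = Fork.old 2 := by
    refine sup_eq_right.2 ((Fork.order_le_iff hL).2 ?_)
    -- `5` is not a fork top, so the meet of z with it falls to `2` or below.
    have key : ∀ x : GluedS7, x ≤ 5 → (x ≤ 3 ∨ 3 ⊓ x ⋖ x ∨ x = 8) → x ≤ 2 := by decide
    have b1 := (Fork.order_le_iff hL).1 (inf_le_left : z ⊓ Fork.old 5 ≤ z)
    have b2 := (Fork.order_le_iff hL).1 (inf_le_right : z ⊓ Fork.old 5 ≤ Fork.old 5)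
    have b3 : (Fork.bounds (z ⊓ Fork.old 5)).2 ≤ 2 := key _ b2.2 (Fork.isForkTop_of_fst_le hL b1.1)
    exact ⟨(Fork.bounds_fst_le _).trans b3, b3⟩
  have e4 : (Fork.old 8 ⊓ Fork.old 5 : Fork square) ⊔ Fork.old 2 = Fork.old 5 := by
    rw [inf_eq_right.2 (hle (by decide)), sup_eq_left.2 (hle (by decide))]
  rw [e3, e4] at h2
  exact absurd ((hβ 2 5).1 h2) (by decide : ¬ classBot 2 = classBot 5)

end GluedS7

open CoveringSquare GluedS7 in
theorem theorem1 :
    (∀ (L : Type*) [Lattice L], IsSPS L → ∀ S : CoveringSquare L,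
      ∃ K : S.ForkLattice, ∀ α : LatticeCon L,
        (S.RestrictsToOne α → K.Extends α) ∧ (S.RestrictsToZero α → K.Extends α)) ∧
    (∃ (L : Type) (_ : Lattice L) (S : CoveringSquare L) (K : S.ForkLattice) (α : LatticeCon L),
      IsSPS L ∧ ¬ S.RestrictsToOne α ∧ ¬ S.RestrictsToZero α ∧ K.Extends α) ∧
    (∃ (L : Type) (_ : Lattice L) (S : CoveringSquare L) (K : S.ForkLattice) (α : LatticeCon L),
      IsSPS L ∧ ¬ S.RestrictsToOne α ∧ ¬ S.RestrictsToZero α ∧ ¬ K.Extends α) := by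
  refine ⟨fun L _ hL S => ?_, ?_, ?_⟩
  · have := hL.finite
    have := hL.semimodular
    exact ⟨forkLattice hL.atMostTwoCovers S, fun α =>
      ⟨fun h => h.extends hL.atMostTwoCovers, fun h => h.extends hL.atMostTwoCovers⟩⟩
  · refine ⟨GluedS7, inferInstance, square, forkLattice isSPS.atMostTwoCovers square, filterCon,
      isSPS, fun h => ?_, fun h => ?_, extends_filterCon _⟩
    · exact absurd (h 3 (Or.inl rfl) 7 (Or.inr (Or.inl rfl)))
        (by decide : ¬ ((7 : GluedS7) ≤ 3 ↔ (7 : GluedS7) ≤ 7))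
    · exact absurd (h 7 (Or.inr (Or.inl rfl)) 8 (Or.inr (Or.inr (Or.inr rfl)))
        (by decide : (7 : GluedS7) ≤ 7 ↔ (7 : GluedS7) ≤ 8)) (by decide)
  · refine ⟨GluedS7, inferInstance, square, forkLattice isSPS.atMostTwoCovers square, edgeCon,
      isSPS, fun h => ?_, fun h => ?_, not_extends_edgeCon _⟩
    · exact absurd (h 3 (Or.inl rfl) 6 (Or.inr (Or.inr (Or.inl rfl))))
        (by decide : ¬ classBot 3 = classBot 6)
    · exact absurd (h 3 (Or.inl rfl) 7 (Or.inr (Or.inl rfl))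
        (by decide : classBot 3 = classBot 7)) (by decide)
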